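/- Fix $d$ and write $\mathbf 1=(1,\dots,1)\in\mathbb R^d$. A map $A:\mathbb R^d\to\mathbb R^d$ is topical if $x\le y$ (coordinatewise) implies $A(x)\le A(y)$, and $A(x+a\mathbf 1)=A(x)+a\mathbf 1$ for all $x\in\mathbb R^d$, $a\in\mathbb R$; a function $\phi:\mathbb R^d\to\mathbb R$ is topical if it is isotone and $\phi(x+a\mathbf 1)=\phi(x)+a$. Let $Top_d$ be the semigroup (under composition) of topical operators on $\mathbb R^d$, with the topology of uniform convergence on compact sets and its Borel $\sigma$-algebra. Let $\overline{x}$ be the class of $x$ in the quotient $\mathbb{PR}^d_{\max}=\mathbb R^d/\mathbb R\mathbf 1$. An operator $A\in Top_d$ has rank $1$ if $\overline{Ax}$ does not depend on $x\in\mathbb R^d$. Let $(A(n))_{n\ge 1}$ be an i.i.d. sequence of $Top_d$-valued random variables with the memory loss property: there is $N\ge 1$ such that $A(N)\cdots A(1)$ has rank $1$ with positive probability. For $x_0\in\mathbb R^d$ put $x(0,x_0)=x_0$ and $x(n,x_0)=A(n)\,x(n-1,x_0)$. Let $S_A\subset Top_d$ be the support of the law of $A(1)$ and $T_A$ the semigroup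 generated by $S_A$. The sequence $(A(n))$ is called algebraically arithmetic if there are $a,b\in\mathbb R$ and $\theta\in Top_d$ of rank $1$ such that for every $A\in S_A$ and every $\theta'\in T_A$ of rank $1$, $$(\theta A\theta'-\theta\theta')(\mathbb R^d)\subset(a+b\mathbb Z)\mathbf 1,$$ and algebraically non-arithmetic otherwise. Let $\phi:\mathbb R^d\to\mathbb R$ be topical and let $\gamma,\sigma\in\mathbb R$ (for instance the Lyapunov exponent of the sequence and the standard deviation in its central limit theorem). Suppose that the conclusion of the local limit theorem holds for every deterministic initial condition, that is: $\sigma>0$ and, for every $x_0\in\mathbb R^d$, there is a $\sigma$-finite measure $\alpha$ on $\mathbb R^d$ such that, for every continuous $h:\mathbb R^d\to\mathbb R$ with compact support, $$\lim_{n\to\infty}\sup_{u\in\mathbb R}\left|\sigma\sqrt{2\pi n}\;\mathbb E\left[h\left(x(n,x_0)-n\gamma\mathbf 1-u\mathbf 1\right)\right]-e^{-\frac{(u+\phi(x_0))^2}{2n\sigma^2}}\int h\,d\alpha\right|=0,$$ and the image of $\alpha$ under $x\mapsto(\overline{x},\phi(x))$ is the product $\nu_0\otimes\mathrm{Leb}$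 of an invariant probability measure $\nu_0$ on $\mathbb{PR}^d_{\max}$ (if $Y$ has law $\nu_0$ and is independent of $A(1)$, then $\overline{A(1)Y}$ has law $\nu_0$) and the Lebesgue measure on $\mathbb R$. Then $(A(n))_{n\ge 1}$ is algebraically non-arithmetic. -/

import Mathlib

open MeasureTheory ProbabilityTheory Filter Topology

noncomputable section

/-- Topical operators on `ℝ^d`: isotone for the product order and additively homogeneous. -/
structure Topical (d : ℕ) where
  toFun : (Fin d → ℝ) → (Fin d → ℝ)
  isotone : ∀ x y, x ≤ y → toFun x ≤ toFun y
  homogeneous : ∀ (x : Fin d → ℝ) (a : ℝ), toFun (x + a • 1) = toFun x + a • 1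

/-- Topical functions from `ℝ^d` to `ℝ`. -/
structure IsTopicalFun {d : ℕ} (φ : (Fin d → ℝ) → ℝ) : Prop where
  isotone : ∀ x y, x ≤ y → φ x ≤ φ y
  homogeneous : ∀ (x : Fin d → ℝ) (a : ℝ), φ (x + a • 1) = φ x + a

/-- The projective space: the quotient of `ℝ^d` by the line spanned by `(1, …, 1)`, with the
quotient topology. The class of `x` is `Submodule.Quotient.mk x`. -/
abbrev ProjSpace (d : ℕ) : Type :=
  (Fin d → ℝ) ⧸ Submodule.span ℝ {(1 : Fin d → ℝ)}

instance ProjSpace.instMeasurableSpace (d : ℕ) : MeasurableSpace (ProjSpace d) :=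
  borel (ProjSpace d)

instance ProjSpace.instBorelSpace (d : ℕ) : BorelSpace (ProjSpace d) := ⟨rfl⟩

namespace Topical

variable {d : ℕ}

instance : CoeFun (Topical d) (fun _ => (Fin d → ℝ) → (Fin d → ℝ)) := ⟨toFun⟩

/-- A topical operator is non-expanding for the sup norm. -/
theorem lipschitz (A : Topical d) : LipschitzWith 1 A := by
  refine LipschitzWith.of_dist_le_mul fun x y => ?_
  have key : ∀ u v : Fin d → ℝ, ∀ i, A u i - A v i ≤ dist u v := by
    intro u v i
    have h : u ≤ v + dist u v • 1 := by
      intro j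
      have h1 : |u j - v j| ≤ dist u v := by
        simpa [Real.dist_eq] using dist_le_pi_dist u v j
      have h2 := le_abs_self (u j - v j)
      simp only [Pi.add_apply, Pi.smul_apply, Pi.one_apply, smul_eq_mul, mul_one]
      linarith
    have h3 := A.isotone _ _ h i
    rw [A.homogeneous] at h3
    simp only [Pi.add_apply, Pi.smul_apply, Pi.one_apply, smul_eq_mul, mul_one] at h3
    linarith
  rw [NNReal.coe_one, one_mul, dist_pi_le_iff dist_nonneg]
  intro i
  rw [Real.dist_eq, abs_le]
  have h1 := key x y i
  have h2 := key y x i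
  rw [dist_comm y x] at h2
  constructor <;> linarith

/-- A topical operator as a continuous map. -/
def toContinuousMap (A : Topical d) : C(Fin d → ℝ, Fin d → ℝ) :=
  ⟨A, A.lipschitz.continuous⟩

/-- The topology of uniform convergence on compact sets, that is, the one induced by the
compact-open topology. -/
instance : TopologicalSpace (Topical d) :=
  TopologicalSpace.induced toContinuousMap inferInstance

instance : MeasurableSpace (Topical d) := borel (Topical d)

instance : BorelSpace (Topical d) := ⟨rfl⟩

/-- Composition of topical operators. -/
instance : Mul (Topical d) where
  mul A B :=
    { toFun := fun x => A (B x)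
      isotone := fun x y h => A.isotone _ _ (B.isotone x y h)
      homogeneous := fun x a => by rw [B.homogeneous, A.homogeneous] }

instance : One (Topical d) where
  one :=
    { toFun := fun x => x
      isotone := fun _ _ h => h
      homogeneous := fun _ _ => rfl }

/-- The semigroup of topical operators under composition. -/
instance : Monoid (Topical d) where
  mul_assoc _ _ _ := rfl
  one_mul _ := rfl
  mul_one _ := rfl

/-- The operator induced by a topical operator on the projective space. -/
def proj (A : Topical d) (p : ProjSpace d) : ProjSpace d :=
  Quotient.liftOn' p (fun x => (Submodule.Quotient.mk (A x) : ProjSpace d)) (by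
    intro x y hxy
    rw [Submodule.quotientRel_def, Submodule.mem_span_singleton] at hxy
    obtain ⟨a, ha⟩ := hxy
    have hx : x = y + a • 1 := by rw [ha]; abel
    show (Submodule.Quotient.mk (A x) : ProjSpace d) = Submodule.Quotient.mk (A y)
    rw [Submodule.Quotient.eq, Submodule.mem_span_singleton]
    exact ⟨a, by rw [hx, A.homogeneous]; abel⟩)

/-- Rank one: the class of `A x` in the projective space does not depend on `x`. -/
def IsRankOne (A : Topical d) : Prop :=
  ∀ x y, (Submodule.Quotient.mk (A x) : ProjSpace d) = Submodule.Quotient.mk (A y)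

/-- The semigroup generated by the support of a measure on topical operators. -/
def generatedSemigroup (μ : Measure (Topical d)) : Subsemigroup (Topical d) :=
  Subsemigroup.closure μ.support

/-- Algebraic arithmeticity of a sequence whose terms have law `μ`: for some `a`, `b` and some
`θ` of rank one, `(θ A θ' - θ θ')(ℝ^d) ⊆ (a + b ℤ) 𝟏` for all `A` in the support and all `θ'` of
rank one in the semigroup generated by the support. -/
def AlgebraicallyArithmetic (μ : Measure (Topical d)) : Prop :=
  ∃ (a b : ℝ) (θ : Topical d), θ.IsRankOne ∧
    ∀ A ∈ μ.support, ∀ θ' ∈ generatedSemigroup μ, θ'.IsRankOne →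
      ∀ x, ∃ k : ℤ, θ (A (θ' x)) - θ (θ' x) = (a + b * k) • (1 : Fin d → ℝ)

/-- Algebraic non-arithmeticity of a sequence whose terms have law `μ`. -/
def AlgebraicallyNonArithmetic (μ : Measure (Topical d)) : Prop :=
  ¬ AlgebraicallyArithmetic μ

/-- `ν` is an invariant probability measure on the projective space: if `A` has law `μ`, `Y` has
law `ν` and they are independent, then `A Y` has law `ν`. -/
def IsInvariantProb (μ : Measure (Topical d)) (ν : Measure (ProjSpace d)) : Prop :=
  IsProbabilityMeasure ν ∧ (μ.prod ν).map (fun p => p.1.proj p.2) = ν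

variable {Ω : Type*}

/-- The sequence `x(0) = x₀`, `x(n) = A(n) x(n-1)`. The operators `A(1), A(2), …` are
`A 0, A 1, …` here. -/
def orbit (A : ℕ → Ω → Topical d) (x₀ : Fin d → ℝ) : ℕ → Ω → (Fin d → ℝ)
  | 0, _ => x₀
  | n + 1, ω => A n ω (orbit A x₀ n ω)

/-- The product `A(n) ⋯ A(1)`, that is, `A (n-1) ⋯ A 0`. -/
def leftProd (A : ℕ → Ω → Topical d) : ℕ → Ω → Topical d
  | 0, _ => 1
  | n + 1, ω => A n ω * leftProd A n ω

variable [MeasurableSpace Ω]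

/-- Independent identically distributed random topical operators. -/
structure IsIID (P : Measure Ω) (A : ℕ → Ω → Topical d) : Prop where
  measurable : ∀ n, Measurable (A n)
  indep : iIndepFun A P
  identDistrib : ∀ n, IdentDistrib (A n) (A 0) P P

/-- The memory loss property. -/
def MemoryLoss (P : Measure Ω) (A : ℕ → Ω → Topical d) : Prop :=
  ∃ N, 1 ≤ N ∧ 0 < P {ω | (leftProd A N ω).IsRankOne}

/-- The conclusion of the local limit theorem for the initial condition `X₀`, with drift `γ` and
standard deviation `σ`: the convergence is uniform in `u`. -/
def LLTConclusion (P : Measure Ω) (A : ℕ → Ω → Topical d) (φ : (Fin d → ℝ) → ℝ) (γ σ : ℝ)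
    (X₀ : Ω → (Fin d → ℝ)) : Prop :=
  0 < σ ∧
  ∃ α : Measure (Fin d → ℝ), SigmaFinite α ∧
    (∀ h : (Fin d → ℝ) → ℝ, Continuous h → HasCompactSupport h →
      TendstoUniformly
        (fun (n : ℕ) (u : ℝ) =>
          σ * √(2 * Real.pi * n) *
              (∫ ω, h (orbit A (X₀ ω) n ω - (n * γ) • 1 - u • 1) ∂P)
            - (∫ ω, Real.exp (-(u + φ (X₀ ω)) ^ 2 / (2 * n * σ ^ 2)) ∂P) * ∫ x, h x ∂α)
        (fun _ => 0) atTop) ∧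
    ∃ ν : Measure (ProjSpace d), IsInvariantProb (P.map (A 0)) ν ∧
      α.map (fun x => ((Submodule.Quotient.mk x : ProjSpace d), φ x)) = ν.prod volume

end Topical

end

/-! Arithmeticity contradicts the local limit theorem for an orbit issued from the range of a rank
one `B` in the semigroup, which memory loss provides. Along that orbit each coordinate of `θ` stays
almost surely in a translate of `b ℤ` depending only on `n` (`orbit_mem_lattice`). Fix a bump `f` of
radius `b / 2` around a point `z` of the support of `α`. For every `n` some shift `u n ∈ [0, b]`
puts the lattice at distance at least `b / 2` from `θ z i` (`exists_shift_lattice_far`). As `θ` is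
non-expanding, the shifted orbit misses the bump and the expectation vanishes. But the shifts are
bounded, so the Gaussian factor tends to `1`, and uniformity in `u` forces `∫ f dα = 0`, whereas
this integral is positive. -/

theorem IsTopicalFun.continuous {d : ℕ} {φ : (Fin d → ℝ) → ℝ} (hφ : IsTopicalFun φ) (i : Fin d) :
    Continuous φ := by
  -- Continuity is inherited from the non-expansiveness of topical operators.
  let B : Topical d :=
    { toFun := fun x => φ x • 1
      isotone := fun x y h j => by simpa using hφ.isotone x y h
      homogeneous := fun x a => by rw [hφ.homogeneous, add_smul] }
  have h : φ = fun x => B x i := by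
    funext x
    simp [B]
  rw [h]
  exact (continuous_apply i).comp B.lipschitz.continuous

/-- A shift `u` in `[0, b)` keeps the whole lattice `c - u + b ℤ` at distance `b / 2` from `t`. -/
theorem exists_shift_lattice_far {b : ℝ} (hb : 0 < b) (c t : ℝ) :
    ∃ u, 0 ≤ u ∧ u ≤ b ∧ ∀ k : ℤ, b / 2 ≤ |c + b * k - u - t| := by
  -- Subtracting `b * Int.fract w` recentres the lattice so that its differences with `t` are
  -- exactly `b / 2 + b ℤ`.
  set w := (c - t - b / 2) / b with hw
  have hwb : c - t - b / 2 = b * w := by rw [hw]; field_simp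
  refine ⟨b * Int.fract w, by have := Int.fract_nonneg w; positivity, ?_, fun k => ?_⟩
  · nlinarith [Int.fract_lt_one w]
  · have h : c + b * k - b * Int.fract w - t = b * ((⌊w⌋ + k : ℤ) : ℝ) + b / 2 := by
      push_cast
      linear_combination hwb - b * Int.floor_add_fract w
    rw [h]
    rcases le_or_gt 0 (⌊w⌋ + k) with hm | hm
    · have : (0 : ℝ) ≤ ((⌊w⌋ + k : ℤ) : ℝ) := by exact_mod_cast hm
      exact le_trans (by nlinarith) (le_abs_self _)
    · have : ((⌊w⌋ + k : ℤ) : ℝ) ≤ -1 := by exact_mod_cast Int.le_sub_one_of_lt hm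
      exact le_trans (by nlinarith) (neg_le_abs _)

namespace Topical

variable {d : ℕ} {Ω : Type*}

/-- Ensures that the support of a law on `Topical d` has full measure. -/
instance : SecondCountableTopology (Topical d) :=
  TopologicalSpace.secondCountableTopology_induced _ _ toContinuousMap

theorem IsRankOne.mul_left {B : Topical d} (hB : B.IsRankOne) (A : Topical d) :
    (A * B).IsRankOne :=
  fun x y => congrArg A.proj (hB x y)

theorem orbit_eq_leftProd (A : ℕ → Ω → Topical d) (x₀ : Fin d → ℝ) (n : ℕ) (ω : Ω) :
    orbit A x₀ n ω = leftProd A n ω x₀ := by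
  induction n with
  | zero => rfl
  | succ n ih => exact congrArg (A n ω) ih

/-- The factor `B` covers `n = 0`, where the empty product is the identity, which need not lie in
`S`. -/
theorem leftProd_mul_mem {A : ℕ → Ω → Topical d} {S : Subsemigroup (Topical d)} {ω : Ω}
    (hω : ∀ n, A n ω ∈ S) {B : Topical d} (hB : B ∈ S) (n : ℕ) : leftProd A n ω * B ∈ S := by
  induction n with
  | zero => exact hB
  | succ n ih =>
    change A n ω * (leftProd A n ω * B) ∈ S
    exact S.mul_mem (hω n) ih

theorem leftProd_succ_mem {A : ℕ → Ω → Topical d} {S : Subsemigroup (Topical d)} {ω : Ω}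
    (hω : ∀ n, A n ω ∈ S) (n : ℕ) : leftProd A (n + 1) ω ∈ S := by
  induction n with
  | zero => exact hω 0
  | succ n ih => exact S.mul_mem (hω (n + 1)) ih

/-- A degenerate lattice `{a}` lies in `a + ℤ`, and the sign of `b` is absorbed by `k`. -/
theorem AlgebraicallyArithmetic.exists_pos {μ : Measure (Topical d)}
    (h : AlgebraicallyArithmetic μ) :
    ∃ (a b : ℝ) (θ : Topical d), 0 < b ∧
      ∀ A ∈ μ.support, ∀ θ' ∈ generatedSemigroup μ, θ'.IsRankOne →
        ∀ x, ∃ k : ℤ, θ (A (θ' x)) - θ (θ' x) = (a + b * k) • (1 : Fin d → ℝ) := by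
  obtain ⟨a, b, θ, -, h⟩ := h
  rcases lt_trichotomy b 0 with hb | rfl | hb
  · refine ⟨a, -b, θ, by linarith, fun A hA θ' hθ' hr x => ?_⟩
    obtain ⟨k, hk⟩ := h A hA θ' hθ' hr x
    exact ⟨-k, by rw [hk]; push_cast; ring_nf⟩
  · refine ⟨a, 1, θ, one_pos, fun A hA θ' hθ' hr x => ?_⟩
    obtain ⟨k, hk⟩ := h A hA θ' hθ' hr x
    exact ⟨0, by rw [hk]; simp⟩
  · exact ⟨a, b, θ, hb, h⟩

/-- Along an orbit issued from the range of a rank one element of the semigroup, arithmeticity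
confines each coordinate of `θ` to a lattice. -/
theorem orbit_mem_lattice {μ : Measure (Topical d)} {a b : ℝ} {θ : Topical d}
    (h : ∀ A ∈ μ.support, ∀ θ' ∈ generatedSemigroup μ, θ'.IsRankOne →
      ∀ x, ∃ k : ℤ, θ (A (θ' x)) - θ (θ' x) = (a + b * k) • (1 : Fin d → ℝ))
    {A : ℕ → Ω → Topical d} {ω : Ω} (hω : ∀ n, A n ω ∈ μ.support)
    {B : Topical d} (hB : B ∈ generatedSemigroup μ) (hr : B.IsRankOne)
    (x : Fin d → ℝ) (i : Fin d) (n : ℕ) :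
    ∃ k : ℤ, θ (orbit A (B x) n ω) i = θ (B x) i + n * a + b * k := by
  induction n with
  | zero => exact ⟨0, by simp [orbit]⟩
  | succ n ih =>
    obtain ⟨k, hk⟩ := ih
    -- Here `θ'` is the random product up to time `n` times `B`, of rank one because `B` is.
    obtain ⟨l, hl⟩ := h (A n ω) (hω n) (leftProd A n ω * B)
      (leftProd_mul_mem (fun m => Subsemigroup.subset_closure (hω m)) hB n) (hr.mul_left _) x
    have hx : (leftProd A n ω * B) x = orbit A (B x) n ω :=
      (orbit_eq_leftProd A (B x) n ω).symm
    rw [hx] at hl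
    have hli := congrFun hl i
    simp only [Pi.sub_apply, Pi.smul_apply, Pi.one_apply, smul_eq_mul, mul_one] at hli
    refine ⟨k + l, ?_⟩
    change θ (A n ω (orbit A (B x) n ω)) i = _
    push_cast
    linear_combination hli + hk

theorem IsIID.ae_mem_support [MeasurableSpace Ω] {P : Measure Ω} {A : ℕ → Ω → Topical d}
    (hA : IsIID P A) : ∀ᵐ ω ∂P, ∀ n, A n ω ∈ (P.map (A 0)).support := by
  refine ae_all_iff.2 fun n => ?_
  have h : ∀ᵐ B ∂(P.map (A n)), B ∈ (P.map (A 0)).support := by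
    rw [(hA.identDistrib n).map_eq]
    exact Measure.support_mem_ae
  exact ae_of_ae_map (hA.measurable n).aemeasurable h

/-- A measure whose image under `x ↦ (class of x, φ x)` is a finite measure times the Lebesgue
measure is finite on compact sets. -/
theorem isFiniteMeasureOnCompacts_of_map_eq {φ : (Fin d → ℝ) → ℝ} (hφ : Continuous φ)
    {α : Measure (Fin d → ℝ)} {ν : Measure (ProjSpace d)} [IsFiniteMeasure ν]
    (h : α.map (fun x => ((Submodule.Quotient.mk x : ProjSpace d), φ x)) = ν.prod volume) :
    IsFiniteMeasureOnCompacts α := by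
  refine ⟨fun K hK => ?_⟩
  have hmk : Continuous (fun x : Fin d → ℝ => (Submodule.Quotient.mk x : ProjSpace d)) :=
    continuous_quot_mk
  have hm : Measurable (fun x => ((Submodule.Quotient.mk x : ProjSpace d), φ x)) :=
    hmk.measurable.prodMk hφ.measurable
  have hφK : IsCompact (φ '' K) := hK.image hφ
  calc α K ≤ α ((fun x => ((Submodule.Quotient.mk x : ProjSpace d), φ x)) ⁻¹'
        (Set.univ ×ˢ (φ '' K))) :=
        measure_mono fun x hx => ⟨trivial, Set.mem_image_of_mem φ hx⟩
    _ = ν Set.univ * volume (φ '' K) := by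
        rw [← Measure.map_apply hm (MeasurableSet.univ.prod hφK.measurableSet), h,
          Measure.prod_prod]
    _ < ⊤ := ENNReal.mul_lt_top (measure_lt_top _ _) hφK.measure_lt_top

end Topical

theorem tendsto_exp_neg_sq_div_of_bounded {σ b p : ℝ} (hσ : 0 < σ) {u : ℕ → ℝ}
    (hu0 : ∀ n, 0 ≤ u n) (hub : ∀ n, u n ≤ b) :
    Tendsto (fun n : ℕ => Real.exp (-(u n + p) ^ 2 / (2 * n * σ ^ 2))) atTop (𝓝 1) := by
  rw [← Real.exp_zero]
  refine (Real.continuous_exp.tendsto 0).comp ?_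
  have hbdd : ∀ n, |-(u n + p) ^ 2 / (2 * n * σ ^ 2)| ≤ (b + |p|) ^ 2 / (2 * σ ^ 2) / n := by
    intro n
    rw [abs_div, abs_neg, abs_of_nonneg (sq_nonneg _),
      abs_of_nonneg (by positivity : (0 : ℝ) ≤ 2 * n * σ ^ 2), div_div]
    have h1 : (u n + p) ^ 2 ≤ (b + |p|) ^ 2 := by
      refine sq_le_sq' ?_ ?_
      · linarith [hu0 n, hub n, neg_abs_le p]
      · linarith [hub n, le_abs_self p]
    rw [show 2 * σ ^ 2 * (n : ℝ) = 2 * n * σ ^ 2 by ring]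
    gcongr
  exact squeeze_zero_norm hbdd (tendsto_const_div_atTop_nhds_zero_nat _)

theorem mainTheorem11 {d : ℕ} {Ω : Type*} [MeasurableSpace Ω]
    (P : Measure Ω) [IsProbabilityMeasure P]
    (A : ℕ → Ω → Topical d) (hA : Topical.IsIID P A) (hMLP : Topical.MemoryLoss P A)
    (φ : (Fin d → ℝ) → ℝ) (hφ : IsTopicalFun φ) (γ σ : ℝ)
    (hLLT : ∀ x₀ : Fin d → ℝ, Topical.LLTConclusion P A φ γ σ (fun _ => x₀)) :
    Topical.AlgebraicallyNonArithmetic (P.map (A 0)) := by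
  intro harith
  obtain ⟨a, b, θ, hb, h⟩ := harith.exists_pos
  have hsupp := hA.ae_mem_support
  -- in dimension zero there is no topical function
  obtain ⟨i⟩ : Nonempty (Fin d) := by
    by_contra hd
    rw [not_nonempty_iff] at hd
    have h1 := hφ.homogeneous 0 1
    rw [Subsingleton.elim ((0 : Fin d → ℝ) + (1 : ℝ) • 1) 0] at h1
    linarith
  -- a rank one element of the semigroup
  obtain ⟨B, hB, hr⟩ : ∃ B ∈ Topical.generatedSemigroup (P.map (A 0)), B.IsRankOne := by
    obtain ⟨N, hN, hpos⟩ := hMLP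
    have hfreq : ∃ᵐ ω ∂P, (Topical.leftProd A N ω).IsRankOne :=
      frequently_ae_iff.2 hpos.ne'
    obtain ⟨ω, hω, hω'⟩ := (hfreq.and_eventually hsupp).exists
    obtain ⟨m, rfl⟩ := Nat.exists_eq_add_of_le' hN
    exact ⟨_, Topical.leftProd_succ_mem (fun n => Subsemigroup.subset_closure (hω' n)) m, hω⟩
  obtain ⟨hσ, α, -, hlim, ν, ⟨hν, -⟩, hmap⟩ := hLLT (B 0)
  -- Local finiteness makes the bump integrable, so that its integral is positive.
  have hfin := Topical.isFiniteMeasureOnCompacts_of_map_eq (hφ.continuous i) hmap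
  have hα : α ≠ 0 := by
    rintro rfl
    rw [Measure.map_zero] at hmap
    have h1 := congrArg (fun m => m (Set.univ ×ˢ Set.univ)) hmap
    simp only [Measure.prod_prod] at h1
    simp at h1
  obtain ⟨z, hz⟩ := Measure.nonempty_support hα
  -- a test function supported in the ball of radius `b / 2` around a point of the support
  set f : (Fin d → ℝ) → ℝ := fun x => max (b / 2 - dist x z) 0 with hf
  have hfc : Continuous f := by fun_prop
  have hfs : Function.support f = Metric.ball z (b / 2) := by
    ext x
    simp only [hf, Function.mem_support, Metric.mem_ball, ne_eq, max_eq_right_iff, not_le,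
      sub_pos]
  have hfk : HasCompactSupport f := by
    refine HasCompactSupport.of_support_subset_isCompact (isCompact_closedBall z (b / 2)) ?_
    rw [hfs]
    exact Metric.ball_subset_closedBall
  have hfpos : 0 < ∫ x, f x ∂α := by
    rw [integral_pos_iff_support_of_nonneg (f := f) (fun x => le_max_right _ _)
      (hfc.integrable_of_hasCompactSupport hfk), hfs]
    exact Measure.mem_support_iff_forall z |>.1 hz _ (Metric.ball_mem_nhds z (by positivity))
  choose u hu0 hub hu using fun n : ℕ =>
    exists_shift_lattice_far hb (θ (B 0) i + n * a - n * γ) (θ z i)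
  have hzero : ∀ n : ℕ,
      ∫ ω, f (Topical.orbit A (B 0) n ω - (n * γ) • 1 - u n • 1) ∂P = 0 := by
    intro n
    refine integral_eq_zero_of_ae ?_
    filter_upwards [hsupp] with ω hω
    obtain ⟨k, hk⟩ := Topical.orbit_mem_lattice h hω hB hr 0 i n
    by_contra hne
    have hball : _ ∈ Function.support f := hne
    rw [hfs, Metric.mem_ball] at hball
    -- A point in the ball would have its `i`-th coordinate under `θ` within `b / 2` of `θ z i`,
    -- against the choice of `u n`.
    have h1 := (dist_le_pi_dist _ _ i).trans (θ.lipschitz.dist_le_mul _ _) |>.trans_lt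
      (by rwa [NNReal.coe_one, one_mul])
    have h2 : θ (Topical.orbit A (B 0) n ω - (n * γ : ℝ) • 1 - u n • 1)
        = θ (Topical.orbit A (B 0) n ω) + (-(n * γ) - u n : ℝ) • 1 := by
      rw [← θ.homogeneous]
      congr 1
      module
    rw [h2, Real.dist_eq] at h1
    simp only [Pi.add_apply, Pi.smul_apply, Pi.one_apply, smul_eq_mul, mul_one, hk] at h1
    refine absurd h1 (not_lt.2 ((hu n k).trans_eq ?_))
    congr 1
    ring
  have hexp := (tendsto_exp_neg_sq_div_of_bounded (p := φ (B 0)) hσ hu0 hub).mul_const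
    (∫ x, f x ∂α)
  have hlim' : Tendsto (fun n : ℕ => Real.exp (-(u n + φ (B 0)) ^ 2 / (2 * n * σ ^ 2)) *
      ∫ x, f x ∂α) atTop (𝓝 0) := by
    rw [Metric.tendsto_atTop]
    intro ε hε
    obtain ⟨n₀, hn₀⟩ := eventually_atTop.1 (Metric.tendstoUniformly_iff.1 (hlim f hfc hfk) ε hε)
    refine ⟨n₀, fun n hn => ?_⟩
    have h1 := hn₀ n hn (u n)
    simpa [hzero n, Real.dist_eq] using h1
  have := tendsto_nhds_unique hexp hlim'
  linarith
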